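/- Let $d\ge 0$, let $\mathbb T^d=\mathbb R^d/\mathbb Z^d$ with its normalized Haar measure, and call an integrable function $f:\mathbb T^d\to\mathbb R$ positive definite if $\widehat f(n)=\int_{\mathbb T^d} e^{-2\pi i\langle n,x\rangle}f(x)\,dx\ge 0$ for all $n\in\mathbb Z^d$. For an open set $\Omega\subseteq\mathbb T^d$ and $z\in\mathbb T^d$ put $$\mathcal M^*(\Omega,z)=\sup\{f(z)\,:\, f:\mathbb T^d\to\mathbb R \text{ positive definite},\ \operatorname{supp} f\subseteq\Omega,\ f(0)=1\},$$ where $\operatorname{supp} f$ is the complement of the largest open set on which $f=0$ almost everywhere, and where $f$ ranges over one of the following function spaces: (a) the continuous functions; (b) the $C^\infty$ functions; (c) the integrable functions that are continuous at $0$ and at $z$. If the open set $\Omega\subseteq\mathbb T^d$ contains all integer multiples of $z$, i.e. $\{nz : n\in\mathbb Z\}\subseteq\Omega$, then $\mathcal M^*(\Omega,z)=1$, for each of the three choices (a), (b), (c) of the function space. -/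

import Mathlib

open MeasureTheory Topology
open scoped ContDiff

namespace PointwiseTuran

/-- The support of a measurable function on the torus, modulo null sets: the complement of the
largest open set on which `f` vanishes almost everywhere. For a continuous function this is the
closure of `{x | f x ≠ 0}`, see `essSupport_eq_tsupport`. -/
def essSupport {d : ℕ} (f : UnitAddTorus (Fin d) → ℝ) : Set (UnitAddTorus (Fin d)) :=
  {x | ∀ U ∈ 𝓝 x, ¬ ∀ᵐ y ∂volume, y ∈ U → f y = 0}

theorem essSupport_eq_tsupport {d : ℕ} {f : UnitAddTorus (Fin d) → ℝ} (hf : Continuous f) :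
    essSupport f = tsupport f := by
  ext x
  constructor
  · intro hx
    by_contra hn
    refine hx (tsupport f)ᶜ ((isClosed_tsupport f).isOpen_compl.mem_nhds hn) ?_
    exact Filter.Eventually.of_forall fun y hy => image_eq_zero_of_notMem_tsupport hy
  · intro hx U hU hae
    obtain ⟨V, hVU, hVo, hxV⟩ := mem_nhds_iff.mp hU
    obtain ⟨y, hyV, hy⟩ := mem_closure_iff.mp hx V hVo hxV
    have hopen : IsOpen (V ∩ Function.support f) := hVo.inter hf.isOpen_support
    refine (hopen.measure_pos volume ⟨y, hyV, hy⟩).ne' ?_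
    refine measure_mono_null ?_ (ae_iff.mp hae)
    intro w hw h
    exact hw.2 (h (hVU hw.1))

/-- A real function on the torus `𝕋^d` is positive definite when it is integrable and all its
Fourier coefficients `∫ exp (-2πi ⟨n, x⟩) f x dx`, `n ∈ ℤ^d`, are nonnegative reals. -/
def PosDef {d : ℕ} (f : UnitAddTorus (Fin d) → ℝ) : Prop :=
  Integrable f ∧ ∀ n : Fin d → ℤ,
    0 ≤ (UnitAddTorus.mFourierCoeff (fun x => (f x : ℂ)) n).re ∧
    (UnitAddTorus.mFourierCoeff (fun x => (f x : ℂ)) n).im = 0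

/-- The `C^∞` functions on `𝕋^d`: those with a `C^∞` periodic lift to `ℝ^d`. -/
def smoothFunctions (d : ℕ) : Set (UnitAddTorus (Fin d) → ℝ) :=
  {f | ContDiff ℝ ∞ (fun x : Fin d → ℝ => f (fun i => (x i : UnitAddCircle)))}

/-- The continuous functions on `𝕋^d`. -/
def continuousFunctions (d : ℕ) : Set (UnitAddTorus (Fin d) → ℝ) :=
  {f | Continuous f}

/-- The integrable functions on `𝕋^d` that are continuous at the two points where they are
evaluated in the extremal problem, `0` and `z`. -/
def integrableFunctions {d : ℕ} (z : UnitAddTorus (Fin d)) : Set (UnitAddTorus (Fin d) → ℝ) :=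
  {f | Integrable f ∧ ContinuousAt f 0 ∧ ContinuousAt f z}

/-- The class `𝓕*(Ω)`, with functions taken from the function space `𝒞`. -/
def Fstar {d : ℕ} (𝒞 : Set (UnitAddTorus (Fin d) → ℝ)) (Ω : Set (UnitAddTorus (Fin d))) :
    Set (UnitAddTorus (Fin d) → ℝ) :=
  {f | f ∈ 𝒞 ∧ essSupport f ⊆ Ω ∧ f 0 = 1 ∧ PosDef f}

/-- The extremal value `𝓜*(Ω, z) = sup {f z | f ∈ 𝓕*(Ω)}`, with functions taken from the
function space `𝒞`; the supremum is taken in the extended reals, so it always exists. -/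
noncomputable def Mstar {d : ℕ} (𝒞 : Set (UnitAddTorus (Fin d) → ℝ))
    (Ω : Set (UnitAddTorus (Fin d))) (z : UnitAddTorus (Fin d)) : EReal :=
  ⨆ f ∈ Fstar 𝒞 Ω, (f z : EReal)

/-- The set `𝓩(z)` of all integer multiples of `z` in `𝕋^d`. -/
def integerMultiples {d : ℕ} (z : UnitAddTorus (Fin d)) : Set (UnitAddTorus (Fin d)) :=
  {x | ∃ n : ℤ, x = n • z}

end PointwiseTuran

/-! Upper bound: test `f` against translates of a smooth even bump `Φ ≥ 0` near `0` whose Fourier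
coefficients are nonnegative and summable. Expanding `Φ` shows `∫ f t * Φ (z - t) ≤ ∫ f t * Φ (0 -
t)`, since a character has real part at most `1`. If `f 0 < f z`, continuity at both points
contradicts this once `Φ` is sufficiently concentrated (`PosDef.apply_le_apply_zero`).

Lower bound: a Fejér-type sum `S x = ∑_{i,j<N} Φ (x - (i z - j z))` is positive definite, and for a
narrow bump its support lies in `Ω`. Shifting by `z` telescopes to `S z = S 0 + Φ (N z) - Φ 0`,
while the diagonal gives `S 0 ≥ N Φ 0`; hence `S z / S 0 ≥ 1 - 1/N`
(`exists_mem_Fstar_smoothFunctions`).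

The lower bound uses smooth functions and the upper bound only continuity at `0` and `z`, so one
argument covers all three spaces. -/

namespace PointwiseTuran

open UnitAddTorus

/-! ### Characters and Fourier coefficients on the torus -/

section Characters

variable {ι : Type*} [Fintype ι]

theorem volume_unitAddCircle_eq_haarAddCircle :
    (volume : Measure UnitAddCircle) = AddCircle.haarAddCircle := by
  simp [AddCircle.volume_eq_smul_haarAddCircle]

/-- Both measures are the normalized Haar measure; writing coefficients with `volume` makes its
invariance and convolution lemmas available. -/
theorem mFourierCoeff_eq_integral_volume (f : UnitAddTorus ι → ℂ) (n : ι → ℤ) :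
    mFourierCoeff f n = ∫ t, mFourier (-n) t * f t := by
  have h : (volume : Measure (UnitAddTorus ι)) = Measure.pi fun _ => AddCircle.haarAddCircle := by
    rw [← volume_unitAddCircle_eq_haarAddCircle]; rfl
  rw [h]
  rfl

theorem mFourier_add_apply (n : ι → ℤ) (x y : UnitAddTorus ι) :
    mFourier n (x + y) = mFourier n x * mFourier n y := by
  simp only [mFourier, ContinuousMap.coe_mk, Pi.add_apply, fourier_apply, smul_add,
    AddCircle.toCircle_add, Circle.coe_mul, Finset.prod_mul_distrib]

theorem mFourier_zero_apply (n : ι → ℤ) : mFourier n (0 : UnitAddTorus ι) = 1 := by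
  simp [mFourier]

theorem norm_mFourier_apply (n : ι → ℤ) (x : UnitAddTorus ι) : ‖mFourier n x‖ = 1 := by
  simp only [mFourier, ContinuousMap.coe_mk, norm_prod, fourier_apply, Circle.norm_coe,
    Finset.prod_const_one]

theorem mFourier_neg_apply (n : ι → ℤ) (x : UnitAddTorus ι) :
    mFourier n (-x) = mFourier (-n) x := by
  simp [mFourier, fourier_apply]

theorem mFourier_neg_apply_eq_conj (n : ι → ℤ) (x : UnitAddTorus ι) :
    mFourier n (-x) = starRingEnd ℂ (mFourier n x) := by
  rw [mFourier_neg_apply, mFourier_neg]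

/-- Bessel's inequality, in its qualitative form. -/
theorem summable_norm_sq_mFourierCoeff (g : C(UnitAddTorus ι, ℂ)) :
    Summable fun n => ‖mFourierCoeff g n‖ ^ 2 := by
  have h := (hasSum_sq_mFourierCoeff (ContinuousMap.toLp 2
    (Measure.pi fun _ : ι => (AddCircle.haarAddCircle : Measure UnitAddCircle)) ℂ g)).summable
  exact h.congr fun n => congrArg (‖·‖ ^ 2) (mFourierCoeff_toLp g n)

end Characters

/-! ### Smoothness under convolution and descent to the torus -/

section Smoothness

/-- Convolving over a compact interval preserves smoothness. -/
theorem contDiff_intervalIntegral_comp_sub_mul {P Q : ℝ → ℝ} (hP : ContDiff ℝ ∞ P)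
    (hQ : Continuous Q) (a b : ℝ) : ContDiff ℝ ∞ fun x => ∫ t in a..b, P (x - t) * Q t := by
  rw [contDiff_infty]
  intro n
  induction n generalizing P with
  | zero =>
    have hPc := hP.continuous
    rw [Nat.cast_zero, contDiff_zero]
    apply intervalIntegral.continuous_parametric_intervalIntegral_of_continuous'
    simp only [Function.uncurry_def]
    fun_prop
  | succ n ih =>
    have hP' : ContDiff ℝ ∞ (deriv P) := (contDiff_infty_iff_deriv.1 hP).2
    have hPd : Differentiable ℝ P := (contDiff_infty_iff_deriv.1 hP).1
    have hPc := hP.continuous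
    have hPc' := hP'.continuous
    have key : ∀ x₀, HasDerivAt (fun x => ∫ t in a..b, P (x - t) * Q t)
        (∫ t in a..b, deriv P (x₀ - t) * Q t) x₀ := by
      intro x₀
      -- Compactness in both variables gives a constant dominating function near `x₀`.
      obtain ⟨C, hC⟩ := ((isCompact_closedBall x₀ 1).prod
        (isCompact_uIcc (a := a) (b := b))).exists_bound_of_continuousOn
        (f := fun p : ℝ × ℝ => deriv P (p.1 - p.2) * Q p.2) (by fun_prop)
      refine (intervalIntegral.hasDerivAt_integral_of_dominated_loc_of_deriv_le
        (F' := fun x t => deriv P (x - t) * Q t) (bound := fun _ => C)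
        (Metric.closedBall_mem_nhds x₀ one_pos) ?_ ?_ ?_ ?_ ?_ ?_).2
      · exact Filter.Eventually.of_forall fun x =>
          (by fun_prop : Continuous fun t => P (x - t) * Q t).aestronglyMeasurable
      · exact (by fun_prop : Continuous fun t => P (x₀ - t) * Q t).intervalIntegrable _ _
      · exact (by fun_prop : Continuous fun t => deriv P (x₀ - t) * Q t).aestronglyMeasurable
      · exact Filter.Eventually.of_forall fun t ht x hx =>
          hC (x, t) ⟨hx, Set.uIoc_subset_uIcc ht⟩
      · exact intervalIntegrable_const
      · exact Filter.Eventually.of_forall fun t _ x _ =>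
          ((hPd _).hasDerivAt.comp_sub_const x t).mul_const (Q t)
    rw [Nat.cast_add, Nat.cast_one, contDiff_succ_iff_deriv]
    refine ⟨fun x => (key x).differentiableAt, by simp, ?_⟩
    rw [show deriv (fun x => ∫ t in a..b, P (x - t) * Q t) = _ from funext fun x => (key x).deriv]
    exact ih hP'

/-- Continuity of the periodic lift descends along the quotient map from `ℝ^d`. -/
theorem continuous_of_mem_smoothFunctions {d : ℕ} {f : UnitAddTorus (Fin d) → ℝ}
    (hf : f ∈ smoothFunctions d) : Continuous f := by
  have hq : IsOpenQuotientMap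
      (fun (x : Fin d → ℝ) (i : Fin d) => (x i : UnitAddCircle)) :=
    IsOpenQuotientMap.piMap fun _ => QuotientAddGroup.isOpenQuotientMap_mk
  exact hq.isQuotientMap.continuous_iff.2
    (show ContDiff ℝ ∞ fun x : Fin d → ℝ => f fun i => (x i : UnitAddCircle) from hf).continuous

end Smoothness

/-! ### A smooth bump on the circle -/

section CircleBump

/-- Smooth even functions on the circle, concentrated near `0`. -/
theorem exists_smooth_bump_unitAddCircle {r : ℝ} (hr : 0 < r) :
    ∃ ψ : UnitAddCircle → ℝ, ContDiff ℝ ∞ (fun x : ℝ => ψ x) ∧ Continuous ψ ∧ (∀ x, 0 ≤ ψ x) ∧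
      (∀ x, ψ (-x) = ψ x) ∧ 0 < ψ 0 ∧ ∀ x, ψ x ≠ 0 → ‖x‖ < r := by
  -- `C` is `cos (2πx)`, whose maximum `1` is attained only at `0`; the bump is a smooth cutoff of
  -- `C` at a level `c < 1`.
  let C : UnitAddCircle → ℝ := fun x => (fourier 1 x).re
  have hCc : Continuous C := by fun_prop
  have hC0 : C 0 = 1 := by simp [C]
  have hCneg : ∀ x, C (-x) = C x := fun x => by
    simp only [C, fourier_apply, smul_neg, AddCircle.toCircle_neg, Circle.coe_inv_eq_conj,
      Complex.conj_re]
  have hClt : ∀ x, x ≠ 0 → C x < 1 := by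
    intro x hx
    have hn : ‖(fourier 1 x : ℂ)‖ = 1 := by rw [fourier_apply, Circle.norm_coe]
    refine lt_of_le_of_ne (hn ▸ Complex.re_le_norm _) fun h => hx ?_
    have h1 : (fourier 1 x : ℂ) = 1 := by
      have h2 := Complex.sq_norm_sub_sq_re (fourier 1 x)
      rw [hn, show (fourier 1 x : ℂ).re = 1 from h] at h2
      apply Complex.ext
      · exact h
      · simpa using h2.symm
    apply AddCircle.injective_toCircle (T := 1) one_ne_zero
    rw [fourier_one] at h1
    ext
    simpa using h1
  obtain ⟨c, hc1, hc⟩ : ∃ c < 1, ∀ x, r ≤ ‖x‖ → C x ≤ c := by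
    have hK : IsCompact {x : UnitAddCircle | r ≤ ‖x‖} :=
      (isClosed_le continuous_const continuous_norm).isCompact
    rcases Set.eq_empty_or_nonempty {x : UnitAddCircle | r ≤ ‖x‖} with he | hne
    · exact ⟨0, one_pos, fun x hx => absurd (show x ∈ {x | r ≤ ‖x‖} from hx) (by simp [he])⟩
    · obtain ⟨y, hy, hmax⟩ := hK.exists_isMaxOn hne hCc.continuousOn
      refine ⟨C y, hClt y ?_, fun x hx => hmax hx⟩
      rintro rfl
      simp only [Set.mem_ofPred_eq, norm_zero] at hy
      linarith
  refine ⟨fun x => Real.smoothTransition (C x - c), ?_, ?_, fun x => Real.smoothTransition.nonneg _,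
    fun x => by simp only [hCneg], Real.smoothTransition.pos_of_pos (by rw [hC0]; linarith), ?_⟩
  · have : ∀ x : ℝ, C x = Real.cos (2 * Real.pi * x) := fun x => by
      simp only [C]
      rw [fourier_coe_apply, show (2 * Real.pi * Complex.I * (1 : ℤ) * x / (1 : ℝ) : ℂ)
        = ((2 * Real.pi * x : ℝ) : ℂ) * Complex.I by push_cast; ring, Complex.exp_ofReal_mul_I_re]
    simp only [this]
    exact Real.smoothTransition.contDiff.comp (by fun_prop)
  · exact Real.smoothTransition.continuous.comp (hCc.sub continuous_const)
  · intro x hx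
    by_contra! h
    exact hx (Real.smoothTransition.zero_of_nonpos (by linarith [hc x h]))

end CircleBump

/-! ### A smooth positive definite bump on the torus -/

section TorusBump

instance isNegInvariant_volume_unitAddTorus (d : ℕ) :
    (volume : Measure (UnitAddTorus (Fin d))).IsNegInvariant :=
  Measure.pi.isNegInvariant (fun _ : Fin d => (volume : Measure UnitAddCircle))

/-- Fourier coefficients turn the convolution square into a square. -/
theorem mFourierCoeff_convolution_self {d : ℕ} {Ψ : UnitAddTorus (Fin d) → ℝ} (hΨ : Continuous Ψ)
    (n : Fin d → ℤ) :
    mFourierCoeff (fun x => ((∫ t, Ψ t * Ψ (x - t) : ℝ) : ℂ)) n =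
      mFourierCoeff (fun x => (Ψ x : ℂ)) n ^ 2 := by
  rw [mFourierCoeff_eq_integral_volume, mFourierCoeff_eq_integral_volume, sq]
  have hu : Integrable fun t => mFourier (-n) t * (Ψ t : ℂ) :=
    (by fun_prop : Continuous fun t => mFourier (-n) t * (Ψ t : ℂ)).integrable_of_hasCompactSupport
      (HasCompactSupport.of_compactSpace _)
  rw [← ContinuousLinearMap.mul_apply' ℂ ℂ, ← integral_convolution _ hu hu]
  refine integral_congr_ae (Filter.Eventually.of_forall fun x => ?_)
  simp only [convolution_def, ContinuousLinearMap.mul_apply']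
  rw [← integral_complex_ofReal, ← integral_const_mul]
  refine integral_congr_ae (Filter.Eventually.of_forall fun t => ?_)
  have : mFourier (-n) x = mFourier (-n) t * mFourier (-n) (x - t) := by
    rw [← mFourier_add_apply, add_sub_cancel]
  simp only [this]
  push_cast
  ring

/-- The Fourier coefficients of a real even function are real. -/
theorem im_mFourierCoeff_eq_zero_of_even {d : ℕ} {Ψ : UnitAddTorus (Fin d) → ℝ}
    (hΨ : ∀ x, Ψ (-x) = Ψ x) (n : Fin d → ℤ) :
    (mFourierCoeff (fun x => (Ψ x : ℂ)) n).im = 0 := by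
  rw [← Complex.conj_eq_iff_im, mFourierCoeff_eq_integral_volume, ← integral_conj,
    ← integral_neg_eq_self]
  refine integral_congr_ae (Filter.Eventually.of_forall fun x => ?_)
  simp only [map_mul, Complex.conj_ofReal, hΨ, mFourier_neg_apply_eq_conj, Complex.conj_conj]

/-- Smooth nonnegative even positive definite functions, concentrated near `0`, with summable
Fourier coefficients. -/
theorem exists_smooth_posDef_bump (d : ℕ) {r : ℝ} (hr : 0 < r) :
    ∃ Φ : UnitAddTorus (Fin d) → ℝ, Φ ∈ smoothFunctions d ∧ (∀ x, 0 ≤ Φ x) ∧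
      (∀ x, Φ (-x) = Φ x) ∧ 0 < Φ 0 ∧ (∀ x, Φ x ≠ 0 → ‖x‖ < r) ∧
      ∃ c : (Fin d → ℤ) → ℝ, (∀ n, 0 ≤ c n) ∧ Summable c ∧
        ∀ n, mFourierCoeff (fun x => (Φ x : ℂ)) n = c n := by
  -- Radius `r / 2`, because the convolution square doubles the support.
  obtain ⟨ψ, hψs, hψc, hψ0, hψe, hψp, hψr⟩ := exists_smooth_bump_unitAddCircle (half_pos hr)
  have hi : ∀ x, Continuous fun t => ψ t * ψ (x - t) := fun x => by fun_prop
  let φ : UnitAddCircle → ℝ := fun x => ∫ t, ψ t * ψ (x - t)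
  let Ψ : UnitAddTorus (Fin d) → ℝ := fun x => ∏ i, ψ (x i)
  have hΨc : Continuous Ψ := by fun_prop
  have hΨe : ∀ x, Ψ (-x) = Ψ x := fun x => by simp [Ψ, hψe]
  have hφs : ContDiff ℝ ∞ fun x : ℝ => φ x := by
    convert! contDiff_intervalIntegral_comp_sub_mul hψs
      (by exact hψs.continuous : Continuous fun x : ℝ => ψ x) 0 (0 + 1) using 2 with x
    simp only [φ]
    rw [← UnitAddCircle.intervalIntegral_preimage 0]
    simp only [mul_comm, ← AddCircle.coe_sub]
  have hφe : ∀ x, φ (-x) = φ x := fun x => by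
    simp only [φ]
    rw [← integral_neg_eq_self]
    refine integral_congr_ae (Filter.Eventually.of_forall fun t => ?_)
    simp only [hψe]
    rw [← hψe (x - t)]
    congr 2
    abel
  have hφp : 0 < φ 0 := by
    refine (hi 0).integral_pos_of_hasCompactSupport_nonneg_nonzero
      (HasCompactSupport.of_compactSpace _) (fun t => mul_nonneg (hψ0 _) (hψ0 _)) (x := 0) ?_
    simpa using hψp.ne'
  have hφr : ∀ x, φ x ≠ 0 → ‖x‖ < r := by
    intro x hx
    obtain ⟨t, ht⟩ : ∃ t, ψ t * ψ (x - t) ≠ 0 := by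
      by_contra! h
      exact hx (by simp [φ, h])
    calc ‖x‖ = ‖t + (x - t)‖ := by rw [add_sub_cancel]
      _ ≤ ‖t‖ + ‖x - t‖ := norm_add_le _ _
      _ < r / 2 + r / 2 := add_lt_add (hψr _ (left_ne_zero_of_mul ht))
          (hψr _ (right_ne_zero_of_mul ht))
      _ = r := add_halves r
  have hconv : ∀ x : UnitAddTorus (Fin d), ∏ i, φ (x i) = ∫ t, Ψ t * Ψ (x - t) := by
    intro x
    simp only [φ, Ψ, ← Finset.prod_mul_distrib, Pi.sub_apply]
    exact (integral_fintype_prod_volume_eq_prod fun i t => ψ t * ψ (x i - t)).symm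
  refine ⟨fun x => ∏ i, φ (x i), ?_, fun x => Finset.prod_nonneg fun i _ =>
    integral_nonneg fun t => mul_nonneg (hψ0 _) (hψ0 _), fun x => by simp [hφe], ?_, ?_,
    -- `Ψ` is real and even, so its coefficients are real; their squares are nonnegative and
    -- summable by Bessel.
    fun n => (mFourierCoeff (fun x => (Ψ x : ℂ)) n).re ^ 2, fun n => sq_nonneg _, ?_, ?_⟩
  · exact contDiff_prod fun i _ => hφs.comp (contDiff_apply ℝ ℝ i)
  · exact Finset.prod_pos fun i _ => hφp
  · intro x hx
    rw [pi_norm_lt_iff hr]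
    exact fun i => hφr _ (Finset.prod_ne_zero_iff.1 hx i (Finset.mem_univ i))
  · refine (summable_norm_sq_mFourierCoeff ⟨fun x => (Ψ x : ℂ), by fun_prop⟩).of_nonneg_of_le
      (fun n => sq_nonneg _) fun n => ?_
    rw [← sq_abs]
    exact pow_le_pow_left₀ (abs_nonneg _) (Complex.abs_re_le_norm _) 2
  · intro n
    simp only [hconv]
    rw [mFourierCoeff_convolution_self hΨc]
    have h := im_mFourierCoeff_eq_zero_of_even hΨe n
    push_cast
    congr 1
    apply Complex.ext <;> simp [h]

end TorusBump

/-! ### Upper bound: domination by the value at the origin -/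

section UpperBound

variable {d : ℕ}

/-- Averaging a positive definite function against a translate of an absolutely convergent Fourier
series with nonnegative coefficients is at most averaging it against the series itself. -/
theorem PosDef.integral_mul_comp_sub_le {f : UnitAddTorus (Fin d) → ℝ} (hf : PosDef f)
    {Φ : UnitAddTorus (Fin d) → ℝ} (hΦ : Continuous Φ) {c : (Fin d → ℤ) → ℝ} (hc0 : ∀ n, 0 ≤ c n)
    (hc : Summable c) (hΦc : ∀ n, mFourierCoeff (fun x => (Φ x : ℂ)) n = c n)
    (z : UnitAddTorus (Fin d)) :
    ∫ t, f t * Φ (z - t) ≤ ∫ t, f t * Φ (0 - t) := by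
  let b : (Fin d → ℤ) → ℝ := fun n => (mFourierCoeff (fun x => (f x : ℂ)) n).re
  have hb : ∀ n, ∫ t, mFourier (-n) t * (f t : ℂ) = b n := fun n => by
    rw [← mFourierCoeff_eq_integral_volume]
    exact Complex.ext rfl (by simp [(hf.2 n).2])
  have hfi : Integrable fun t => (f t : ℂ) := hf.1.ofReal
  have hΦs : ∀ x, HasSum (fun n => (c n : ℂ) * mFourier n x) (Φ x) := fun x => by
    have h := hasSum_mFourier_series_apply_of_summable
      (f := ⟨fun x => (Φ x : ℂ), by fun_prop⟩) ?_ x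
    · simpa [hΦc] using h
    · refine Summable.congr ?_ fun n => (hΦc n).symm
      exact_mod_cast hc
  -- Termwise integration is justified by `∑ c n * ‖f‖₁ < ∞`; no summability of the coefficients of
  -- `f` is needed.
  have hS : ∀ y, HasSum (fun n => c n * b n * (mFourier n y).re) (∫ t, f t * Φ (y - t)) := by
    intro y
    have hbound : ∀ n t, ‖(f t : ℂ) * (c n * mFourier n (y - t))‖ = c n * ‖(f t : ℂ)‖ := by
      intro n t
      rw [norm_mul, norm_mul, norm_mFourier_apply, mul_one, Complex.norm_of_nonneg (hc0 n),
        mul_comm]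
    have hint : ∀ n, Integrable fun t => (f t : ℂ) * (c n * mFourier n (y - t)) := fun n =>
      (hfi.norm.const_mul (c n)).mono'
        (hfi.1.mul (by fun_prop : Continuous fun t =>
          (c n : ℂ) * mFourier n (y - t)).aestronglyMeasurable)
        (Filter.Eventually.of_forall fun t => (hbound n t).le)
    have h := hasSum_integral_of_summable_integral_norm hint (by
      simp only [hbound, integral_const_mul]
      exact hc.mul_right _)
    have h1 : ∀ n, ∫ t, (f t : ℂ) * (c n * mFourier n (y - t)) = (c n * b n : ℝ) * mFourier n y := by
      intro n
      rw [Complex.ofReal_mul, ← hb, ← integral_const_mul, ← integral_mul_const]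
      refine integral_congr_ae (Filter.Eventually.of_forall fun t => ?_)
      simp only
      rw [sub_eq_add_neg, mFourier_add_apply, mFourier_neg_apply]
      ring
    have h2 : ∀ t, ∑' n, (f t : ℂ) * (c n * mFourier n (y - t)) = ((f t * Φ (y - t) : ℝ) : ℂ) := by
      intro t
      rw [tsum_mul_left, (hΦs (y - t)).tsum_eq, Complex.ofReal_mul]
    simp only [h1, h2, integral_complex_ofReal] at h
    simpa only [Complex.re_ofReal_mul, Complex.ofReal_re] using Complex.hasSum_re h
  refine hasSum_le (fun n => ?_) (hS z) (hS 0)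
  rw [mFourier_zero_apply, Complex.one_re]
  refine mul_le_mul_of_nonneg_left ?_ (mul_nonneg (hc0 n) (hf.2 n).1)
  exact (Complex.re_le_norm _).trans (norm_mFourier_apply n z).le

/-- A positive definite function is largest at the origin among its points of continuity. -/
theorem PosDef.apply_le_apply_zero {f : UnitAddTorus (Fin d) → ℝ} (hf : PosDef f)
    {z : UnitAddTorus (Fin d)} (h0 : ContinuousAt f 0) (hz : ContinuousAt f z) : f z ≤ f 0 := by
  by_contra! hlt
  obtain ⟨m, hm0, hm⟩ := exists_between hlt
  obtain ⟨m', hm', hmz⟩ := exists_between hm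
  obtain ⟨δ₀, hδ₀, h0⟩ := Metric.eventually_nhds_iff.1 (h0.eventually (gt_mem_nhds hm0))
  obtain ⟨δ₁, hδ₁, hz⟩ := Metric.eventually_nhds_iff.1 (hz.eventually (lt_mem_nhds hmz))
  obtain ⟨Φ, hΦs, hΦ0, hΦe, hΦp, hΦr, c, hc0, hc, hΦc⟩ :=
    exists_smooth_posDef_bump d (lt_min hδ₀ hδ₁)
  have hΦcont := continuous_of_mem_smoothFunctions hΦs
  have hint : ∀ y, Integrable fun t => Φ (y - t) := fun y =>
    (by fun_prop : Continuous fun t => Φ (y - t)).integrable_of_hasCompactSupport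
      (HasCompactSupport.of_compactSpace _)
  have hfint : ∀ y, Integrable fun t => f t * Φ (y - t) := by
    intro y
    obtain ⟨C, hC⟩ := isCompact_univ.exists_bound_of_continuousOn hΦcont.continuousOn
    exact hf.1.mul_bdd (c := C) (hint y).1
      (Filter.Eventually.of_forall fun t => hC _ (Set.mem_univ _))
  have hpos : 0 < ∫ t, Φ t :=
    hΦcont.integral_pos_of_hasCompactSupport_nonneg_nonzero
      (HasCompactSupport.of_compactSpace _) hΦ0 hΦp.ne'
  have hle := hf.integral_mul_comp_sub_le hΦcont hc0 hc hΦc z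
  -- Where `Φ (z - t) ≠ 0`, the point `t` is so close to `z` that `f t > m'`.
  have hlow : m' * ∫ t, Φ t ≤ ∫ t, f t * Φ (z - t) := by
    rw [← integral_sub_left_eq_self Φ volume z, ← integral_const_mul]
    refine integral_mono ((hint z).const_mul _) (hfint z) fun t => ?_
    by_cases h : Φ (z - t) = 0
    · simp [h]
    · refine mul_le_mul_of_nonneg_right (hz ?_).le (hΦ0 _)
      rw [dist_comm, dist_eq_norm]
      exact (hΦr _ h).trans_le (min_le_right _ _)
  have hup : ∫ t, f t * Φ (0 - t) ≤ m * ∫ t, Φ t := by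
    rw [← integral_sub_left_eq_self Φ volume 0, ← integral_const_mul]
    refine integral_mono (hfint 0) ((hint 0).const_mul _) fun t => ?_
    by_cases h : Φ (0 - t) = 0
    · simp only [h, mul_zero, le_refl]
    · refine mul_le_mul_of_nonneg_right (h0 ?_).le (hΦ0 _)
      rw [dist_comm, dist_eq_norm]
      exact (hΦr _ h).trans_le (min_le_left _ _)
  nlinarith

end UpperBound

/-! ### Lower bound: Fejér-type superpositions of bumps -/

section LowerBound

variable {d : ℕ}

theorem mFourierCoeff_comp_sub (f : UnitAddTorus (Fin d) → ℂ) (a : UnitAddTorus (Fin d))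
    (n : Fin d → ℤ) :
    mFourierCoeff (fun x => f (x - a)) n = mFourier (-n) a * mFourierCoeff f n := by
  rw [mFourierCoeff_eq_integral_volume, mFourierCoeff_eq_integral_volume, ← integral_const_mul,
    ← integral_add_right_eq_self _ a]
  refine integral_congr_ae (Filter.Eventually.of_forall fun x => ?_)
  simp only [add_sub_cancel_right, mFourier_add_apply]
  ring

/-- Superposing the translates of a positive definite function along all differences of a finite
family of points gives a positive definite function. -/
theorem PosDef.const_mul_sum_comp_sub {Φ : UnitAddTorus (Fin d) → ℝ} (hΦ : PosDef Φ)
    {ι : Type*} (s : Finset ι) (a : ι → UnitAddTorus (Fin d)) {A : ℝ} (hA : 0 ≤ A) :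
    PosDef fun x => A * ∑ i ∈ s, ∑ j ∈ s, Φ (x - (a i - a j)) := by
  have hint : ∀ i j, Integrable fun x => Φ (x - (a i - a j)) := fun i j =>
    hΦ.1.comp_sub_right _
  refine ⟨(integrable_finsetSum _ fun i _ => integrable_finsetSum _ fun j _ =>
    hint i j).const_mul _, fun n => ?_⟩
  have hm : ∀ i j, Integrable fun t => mFourier (-n) t * (Φ (t - (a i - a j)) : ℂ) := fun i j =>
    (hint i j).ofReal.bdd_mul (c := 1)
      (mFourier (-n)).continuous.aestronglyMeasurable
      (Filter.Eventually.of_forall fun t => (norm_mFourier_apply _ _).le)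
  -- Translation by `a i - a j` multiplies the coefficient by a character value times a conjugate
  -- one, so the double sum factors as a squared modulus.
  have key : mFourierCoeff (fun x => ((A * ∑ i ∈ s, ∑ j ∈ s, Φ (x - (a i - a j)) : ℝ) : ℂ)) n =
      (A * Complex.normSq (∑ i ∈ s, mFourier (-n) (a i)) : ℝ) *
        mFourierCoeff (fun x => (Φ x : ℂ)) n := by
    have h1 : ∀ t, mFourier (-n) t * ((A * ∑ i ∈ s, ∑ j ∈ s, Φ (t - (a i - a j)) : ℝ) : ℂ) =
        A * ∑ i ∈ s, ∑ j ∈ s, mFourier (-n) t * (Φ (t - (a i - a j)) : ℂ) := fun t => by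
      push_cast
      simp only [Finset.mul_sum]
      refine Finset.sum_congr rfl fun i _ => Finset.sum_congr rfl fun j _ => by ring
    have h2 : ∀ i j, ∫ t, mFourier (-n) t * (Φ (t - (a i - a j)) : ℂ) =
        mFourier (-n) (a i) * starRingEnd ℂ (mFourier (-n) (a j)) *
          mFourierCoeff (fun x => (Φ x : ℂ)) n := fun i j => by
      rw [← mFourierCoeff_eq_integral_volume, mFourierCoeff_comp_sub (fun x => (Φ x : ℂ)),
        sub_eq_add_neg, mFourier_add_apply, mFourier_neg_apply_eq_conj]
    rw [mFourierCoeff_eq_integral_volume]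
    simp only [h1]
    rw [integral_const_mul, integral_finsetSum _ fun i _ => integrable_finsetSum _ fun j _ => hm i j]
    simp only [integral_finsetSum _ fun j _ => hm _ j, h2]
    rw [Complex.ofReal_mul, ← Complex.mul_conj, map_sum, Finset.sum_mul_sum]
    simp only [← Finset.sum_mul]
    ring
  rw [key, Complex.re_ofReal_mul, Complex.im_ofReal_mul, (hΦ.2 n).2, mul_zero]
  exact ⟨mul_nonneg (mul_nonneg hA (Complex.normSq_nonneg _)) (hΦ.2 n).1, rfl⟩

/-- Shifting the double sum of an even function over differences of multiples of `z` by one step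
changes it only by a boundary term. -/
theorem sum_sum_apply_sub_shift {G : Type*} [AddCommGroup G] {Φ : G → ℝ} (hΦ : ∀ x, Φ (-x) = Φ x)
    (z : G) (N : ℕ) :
    ∑ i ∈ Finset.range N, ∑ j ∈ Finset.range N, Φ (z - (i • z - j • z)) =
      ∑ i ∈ Finset.range N, ∑ j ∈ Finset.range N, Φ (0 - (i • z - j • z)) + Φ (N • z) - Φ 0 := by
  have h1 : ∀ i : ℕ, ∑ j ∈ Finset.range N, Φ (z - (i • z - j • z)) =
      ∑ j ∈ Finset.range N, Φ (0 - (i • z - j • z)) + Φ (N • z - i • z) - Φ (i • z) := by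
    intro i
    have h := Finset.sum_range_succ' (fun j : ℕ => Φ (0 - (i • z - j • z))) N
    rw [Finset.sum_range_succ] at h
    have e1 : ∀ j : ℕ, z - (i • z - j • z) = 0 - (i • z - (j + 1) • z) := fun j => by
      rw [succ_nsmul]; abel
    have e2 : 0 - (i • z - N • z) = N • z - i • z := by abel
    have e3 : Φ (0 - (i • z - 0 • z)) = Φ (i • z) := by simp [hΦ]
    rw [e2, e3] at h
    simp only [e1]
    linarith
  -- Reindexing `i ↦ N - 1 - i` makes the boundary terms telescope.
  have h2 : ∑ i ∈ Finset.range N, Φ (N • z - i • z) =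
      ∑ i ∈ Finset.range N, Φ ((i + 1) • z) := by
    rw [← Finset.sum_range_reflect]
    refine Finset.sum_congr rfl fun i hi => ?_
    have hi' := Finset.mem_range.1 hi
    congr 1
    rw [sub_eq_iff_eq_add, ← add_nsmul]
    congr 1
    omega
  have h3 := Finset.sum_range_succ' (fun i : ℕ => Φ (i • z)) N
  rw [Finset.sum_range_succ, zero_smul] at h3
  simp only [h1, Finset.sum_sub_distrib, Finset.sum_add_distrib, h2]
  linarith

theorem comp_sub_mem_smoothFunctions {Φ : UnitAddTorus (Fin d) → ℝ} (hΦ : Φ ∈ smoothFunctions d)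
    (a : UnitAddTorus (Fin d)) : (fun x => Φ (x - a)) ∈ smoothFunctions d := by
  choose w hw using fun k => QuotientAddGroup.mk_surjective (a k)
  have ha : a = fun k => (w k : UnitAddCircle) := funext fun k => (hw k).symm
  subst ha
  have h : ContDiff ℝ ∞ fun x : Fin d → ℝ => Φ fun k => ((x k : ℝ) : UnitAddCircle) := hΦ
  exact h.comp (contDiff_id.sub (contDiff_const (c := w)))

theorem exists_mem_Fstar_smoothFunctions {Ω : Set (UnitAddTorus (Fin d))} (hΩ : IsOpen Ω)
    {z : UnitAddTorus (Fin d)} (hz : integerMultiples z ⊆ Ω) {N : ℕ} (hN : 0 < N) :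
    ∃ f ∈ Fstar (smoothFunctions d) Ω, 1 - 1 / (N : ℝ) ≤ f z := by
  have hmem : ∀ i j : ℕ, i • z - j • z ∈ Ω := fun i j =>
    hz ⟨(i : ℤ) - j, by rw [sub_smul, natCast_zsmul, natCast_zsmul]⟩
  -- Finitely many centres allow a common radius; closed balls make the union closed, so it also
  -- contains the closure of the support.
  obtain ⟨r, hr, hrΩ⟩ : ∃ r > 0, ∀ i ∈ Finset.range N, ∀ j ∈ Finset.range N,
      Metric.closedBall (i • z - j • z) r ⊆ Ω := by
    have h : ∀ᶠ r : ℝ in 𝓝[>] 0, ∀ i ∈ Finset.range N, ∀ j ∈ Finset.range N,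
        Metric.closedBall (i • z - j • z) r ⊆ Ω := by
      simp only [Filter.eventually_all_finset]
      intro i _ j _
      obtain ⟨δ, hδ, h⟩ := Metric.isOpen_iff.1 hΩ _ (hmem i j)
      filter_upwards [Ioo_mem_nhdsGT hδ] with r hr
      exact (Metric.closedBall_subset_ball hr.2).trans h
    obtain ⟨r, h1, h2⟩ := (h.and self_mem_nhdsWithin).exists
    exact ⟨r, h2, h1⟩
  obtain ⟨Φ, hΦs, hΦ0, hΦe, hΦp, hΦr, c, hc0, -, hΦc⟩ := exists_smooth_posDef_bump d hr
  have hΦcont := continuous_of_mem_smoothFunctions hΦs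
  have hΦP : PosDef Φ := ⟨hΦcont.integrable_of_hasCompactSupport
    (HasCompactSupport.of_compactSpace _), fun n => by simp [hΦc, hc0]⟩
  let S : UnitAddTorus (Fin d) → ℝ := fun x =>
    ∑ i ∈ Finset.range N, ∑ j ∈ Finset.range N, Φ (x - (i • z - j • z))
  have hS0 : N * Φ 0 ≤ S 0 := by
    calc N * Φ 0 = ∑ i ∈ Finset.range N, Φ (0 - (i • z - i • z)) := by simp
      _ ≤ S 0 := Finset.sum_le_sum fun i hi =>
        Finset.single_le_sum (f := fun j : ℕ => Φ (0 - (i • z - j • z))) (fun j _ => hΦ0 _) hi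
  have hNpos : (0 : ℝ) < N := Nat.cast_pos.2 hN
  have hSpos : 0 < S 0 := (mul_pos hNpos hΦp).trans_le hS0
  have hfs : (fun x => (S 0)⁻¹ * S x) ∈ smoothFunctions d := by
    have h : ∀ i j : ℕ, ContDiff ℝ ∞ fun x : Fin d → ℝ =>
        Φ ((fun k => (x k : UnitAddCircle)) - (i • z - j • z)) :=
      fun i j => comp_sub_mem_smoothFunctions hΦs _
    exact contDiff_const.mul (ContDiff.sum fun i _ => ContDiff.sum fun j _ => h i j)
  refine ⟨fun x => (S 0)⁻¹ * S x, ⟨hfs, ?_, inv_mul_cancel₀ hSpos.ne',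
    hΦP.const_mul_sum_comp_sub _ (fun i : ℕ => i • z) (inv_nonneg.2 hSpos.le)⟩, ?_⟩
  · rw [essSupport_eq_tsupport (continuous_of_mem_smoothFunctions hfs)]
    have hclosed : IsClosed (⋃ i ∈ Finset.range N, ⋃ j ∈ Finset.range N,
        Metric.closedBall (i • z - j • z) r) :=
      isClosed_biUnion_finset fun i _ => isClosed_biUnion_finset fun j _ =>
        Metric.isClosed_closedBall
    refine (closure_minimal (fun x hx => ?_) hclosed).trans
      (Set.iUnion₂_subset fun i hi => Set.iUnion₂_subset fun j hj => hrΩ i hi j hj)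
    obtain ⟨i, hi, hx⟩ := Finset.exists_ne_zero_of_sum_ne_zero (right_ne_zero_of_mul hx)
    obtain ⟨j, hj, hx⟩ := Finset.exists_ne_zero_of_sum_ne_zero hx
    refine Set.mem_biUnion hi (Set.mem_biUnion hj ?_)
    rw [Metric.mem_closedBall, dist_eq_norm]
    exact (hΦr _ hx).le
  · have hSz : S z = S 0 + Φ (N • z) - Φ 0 := sum_sum_apply_sub_shift hΦe z N
    have h1 := hΦ0 (N • z)
    simp only
    rw [inv_mul_eq_div, le_div_iff₀ hSpos, hSz, sub_mul, one_mul, one_div, inv_mul_eq_div]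
    have : Φ 0 ≤ S 0 / N := by rwa [le_div_iff₀ hNpos, mul_comm]
    linarith

end LowerBound

/-! ### The extremal value for all function spaces in between -/

theorem Fstar_mono {d : ℕ} {𝒞 𝒞' : Set (UnitAddTorus (Fin d) → ℝ)} (h : 𝒞 ⊆ 𝒞')
    (Ω : Set (UnitAddTorus (Fin d))) : Fstar 𝒞 Ω ⊆ Fstar 𝒞' Ω :=
  fun _ hf => ⟨h hf.1, hf.2⟩

theorem continuousFunctions_subset_integrableFunctions {d : ℕ} (z : UnitAddTorus (Fin d)) :
    continuousFunctions d ⊆ integrableFunctions z := fun _ hf =>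
  ⟨Continuous.integrable_of_hasCompactSupport hf (HasCompactSupport.of_compactSpace _),
    Continuous.continuousAt hf, Continuous.continuousAt hf⟩

/-- Any function space between the smooth functions and the integrable functions continuous at `0`
and `z` gives the extremal value `1`. -/
theorem Mstar_eq_one {d : ℕ} {Ω : Set (UnitAddTorus (Fin d))} (hΩ : IsOpen Ω)
    {z : UnitAddTorus (Fin d)} (hz : integerMultiples z ⊆ Ω)
    {𝒞 : Set (UnitAddTorus (Fin d) → ℝ)} (h₁ : smoothFunctions d ⊆ 𝒞)
    (h₂ : 𝒞 ⊆ integrableFunctions z) : Mstar 𝒞 Ω z = 1 := by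
  apply le_antisymm
  · refine iSup₂_le fun f hf => ?_
    have h := hf.2.2.2.apply_le_apply_zero (h₂ hf.1).2.1 (h₂ hf.1).2.2
    rw [hf.2.2.1] at h
    exact_mod_cast h
  · refine le_of_forall_lt fun y hy => ?_
    obtain ⟨q, hyq, hq⟩ := EReal.lt_iff_exists_real_btwn.1 hy
    have hq1 : q < 1 := by exact_mod_cast hq
    obtain ⟨N, hN⟩ := exists_nat_one_div_lt (sub_pos.2 hq1)
    obtain ⟨f, hf, hfz⟩ := exists_mem_Fstar_smoothFunctions hΩ hz N.succ_pos
    refine hyq.trans_le ((EReal.coe_le_coe_iff.2 ?_).trans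
      (le_iSup₂_of_le (f := fun f (_ : f ∈ Fstar 𝒞 Ω) => (f z : EReal)) f
        (Fstar_mono h₁ Ω hf) le_rfl))
    push_cast at hfz
    linarith

end PointwiseTuran

theorem mainTheorem10 (d : ℕ) (Ω : Set (UnitAddTorus (Fin d))) (hΩ : IsOpen Ω)
    (z : UnitAddTorus (Fin d)) (hz : PointwiseTuran.integerMultiples z ⊆ Ω) :
    PointwiseTuran.Mstar (PointwiseTuran.continuousFunctions d) Ω z = 1 ∧
    PointwiseTuran.Mstar (PointwiseTuran.smoothFunctions d) Ω z = 1 ∧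
    PointwiseTuran.Mstar (PointwiseTuran.integrableFunctions z) Ω z = 1 := by
  have h₁ : PointwiseTuran.smoothFunctions d ⊆ PointwiseTuran.continuousFunctions d :=
    fun _ => PointwiseTuran.continuous_of_mem_smoothFunctions
  have h₂ := PointwiseTuran.continuousFunctions_subset_integrableFunctions z
  exact ⟨PointwiseTuran.Mstar_eq_one hΩ hz h₁ h₂,
    PointwiseTuran.Mstar_eq_one hΩ hz subset_rfl (h₁.trans h₂),
    PointwiseTuran.Mstar_eq_one hΩ hz (h₁.trans h₂) subset_rfl⟩
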